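/- All graphs are finite, simple and undirected. A maximal induced bipartite subgraph of a graph $G$ is an induced subgraph of $G$ that is bipartite and is not properly contained in another bipartite induced subgraph of $G$. There exists a real number $\nu$ with $0<\nu<12$ such that the following two statements hold. (i) There is a constant $C>0$ such that, for every non-negative integer $n$, every $K_4$-free graph of order $n$ has at most $C\,(12-\nu)^{n/4}$ maximal induced bipartite subgraphs. (ii) There is a constant $C>0$ such that, for every non-negative integer $n$, every graph of order $n$ and maximum degree at most $3$ has at most $C\,(12-\nu)^{n/4}$ maximal induced bipartite subgraphs. -/

import Mathlib

universe u

namespace SimpleGraph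

/-- `H` is a maximal induced bipartite subgraph of `G`: it is an induced subgraph of `G` that is
bipartite, and it is not properly contained in another bipartite induced subgraph of `G`. -/
def IsMaximalInducedBipartite {V : Type u} (G : SimpleGraph V) (H : G.Subgraph) : Prop :=
  Maximal (fun K : G.Subgraph => K.IsInduced ∧ K.coe.IsBipartite) H

/-- The number of maximal induced bipartite subgraphs of `G` (used for finite graphs only). -/
noncomputable def numMaximalInducedBipartite {V : Type u} (G : SimpleGraph V) : ℕ :=
  {H : G.Subgraph | G.IsMaximalInducedBipartite H}.ncard

end SimpleGraph

namespace SimpleGraph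

variable {V : Type u} [DecidableEq V] (G : SimpleGraph V)

/-! A maximal bipartite set is `I ∪ J` with `I` maximal independent in `W` and `J` maximal
independent in `W \ I`. There are at most about `3^((|W| - |I|)/3)` choices of `J`, so what remains
is to bound `∑ y^|I|` with `y ≈ 3^(-1/3)`. Branching on a smallest closed neighbourhood, of size
`r`, gives `r` branches of weight `y`, each losing at least `r` vertices. This yields the bound
`c^|W|` once `r * y ≤ c^r` for every `r` that occurs. Only `r = 4` forces `c^4 = 4y`, whence
`3^(4/3) * 4 * 3^(-1/3) = 12`. Without `K₄` the case `r = 4` improves: either a neighbour has a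
larger closed neighbourhood, or each branch creates a vertex of degree at most 2, where branching
again gains a factor. So `c = 1.29` works (`indepWeight_le_pow_of_cliqueFree`), and `(1.4423 *
1.29)^4 < 12`. With maximum degree at most 3, a `K₄` is a component and contributes a factor of at
most `11 < 12`. -/

open Classical in
/-- The maximal independent sets of the subgraph of `G` induced by `W`. -/
noncomputable def maximalIndepSets (W : Finset V) : Finset (Finset V) :=
  {A ∈ W.powerset | G.IsIndepSet (A : Set V) ∧ ∀ w ∈ W, w ∉ A → ∃ a ∈ A, G.Adj a w}

open Classical in
/-- The closed neighbourhood of `u` inside `W`. -/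
noncomputable def closedNbhd (W : Finset V) (u : V) : Finset V :=
  {w ∈ W | w = u ∨ G.Adj u w}

/-- The generating function of the maximal independent sets inside `W`, counted by size. -/
noncomputable def indepWeight (y : ℝ) (W : Finset V) : ℝ :=
  ∑ A ∈ G.maximalIndepSets W, y ^ A.card

/-- `S` induces a bipartite subgraph: it is the union of two independent sets. -/
def IsBipartiteSet (S : Finset V) : Prop :=
  ∃ A B : Finset V, G.IsIndepSet (A : Set V) ∧ G.IsIndepSet (B : Set V) ∧ S = A ∪ B

open Classical in
/-- The maximal subsets of `W` that induce a bipartite subgraph. -/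
noncomputable def maximalBipartiteSets (W : Finset V) : Finset (Finset V) :=
  {S ∈ W.powerset | G.IsBipartiteSet S ∧ ∀ T ⊆ W, G.IsBipartiteSet T → S ⊆ T → T = S}

variable {G}

lemma mem_maximalIndepSets {W A : Finset V} :
    A ∈ G.maximalIndepSets W ↔
      A ⊆ W ∧ G.IsIndepSet (A : Set V) ∧ ∀ w ∈ W, w ∉ A → ∃ a ∈ A, G.Adj a w := by
  simp [maximalIndepSets]

lemma mem_closedNbhd {W : Finset V} {u w : V} :
    w ∈ G.closedNbhd W u ↔ w ∈ W ∧ (w = u ∨ G.Adj u w) := by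
  simp [closedNbhd]

lemma mem_maximalBipartiteSets {W S : Finset V} :
    S ∈ G.maximalBipartiteSets W ↔
      S ⊆ W ∧ G.IsBipartiteSet S ∧ ∀ T ⊆ W, G.IsBipartiteSet T → S ⊆ T → T = S := by
  simp [maximalBipartiteSets]

lemma closedNbhd_subset (W : Finset V) (u : V) : G.closedNbhd W u ⊆ W :=
  fun _ h => (mem_closedNbhd.1 h).1

lemma self_mem_closedNbhd {W : Finset V} {u : V} (hu : u ∈ W) : u ∈ G.closedNbhd W u :=
  mem_closedNbhd.2 ⟨hu, Or.inl rfl⟩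

lemma mem_closedNbhd_comm {W : Finset V} {u w : V} (hu : u ∈ W) (h : w ∈ G.closedNbhd W u) :
    u ∈ G.closedNbhd W w := by
  rw [mem_closedNbhd] at h ⊢
  exact ⟨hu, h.2.imp Eq.symm fun h => h.symm⟩

/-! ### Branching for weighted maximal independent sets -/

lemma indepWeight_empty (y : ℝ) : G.indepWeight y ∅ = 1 := by
  have : G.maximalIndepSets ∅ = {∅} := by
    ext A
    simp only [mem_maximalIndepSets, Finset.subset_empty, Finset.mem_singleton]
    constructor
    · exact fun h => h.1
    · rintro rfl
      simp [IsIndepSet]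
  simp [indepWeight, this]

lemma erase_mem_maximalIndepSets {W A : Finset V} {u : V} (hA : A ∈ G.maximalIndepSets W)
    (hu : u ∈ A) : A.erase u ∈ G.maximalIndepSets (W \ G.closedNbhd W u) := by
  rw [mem_maximalIndepSets] at hA ⊢
  obtain ⟨hAW, hI, hM⟩ := hA
  refine ⟨fun a ha => ?_, hI.mono (by simp), fun w hw hwA => ?_⟩
  · obtain ⟨hau, haA⟩ := Finset.mem_erase.1 ha
    rw [Finset.mem_sdiff, mem_closedNbhd]
    refine ⟨hAW haA, ?_⟩
    rintro ⟨-, h | h⟩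
    · exact hau h
    · exact hI hu haA (Ne.symm hau) h
  · rw [Finset.mem_sdiff, mem_closedNbhd] at hw
    have hwu : w ≠ u := fun h => hw.2 ⟨hw.1, Or.inl h⟩
    obtain ⟨a, ha, haw⟩ := hM w hw.1 fun h => hwA (Finset.mem_erase.2 ⟨hwu, h⟩)
    refine ⟨a, Finset.mem_erase.2 ⟨?_, ha⟩, haw⟩
    rintro rfl
    exact hw.2 ⟨hw.1, Or.inr haw⟩

/-- A maximal independent set meets the closed neighbourhood of each vertex. -/
lemma indepWeight_le_sum {y : ℝ} (hy : 0 ≤ y) {W : Finset V} {v : V} (hv : v ∈ W) :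
    G.indepWeight y W ≤
      ∑ u ∈ G.closedNbhd W v, y * G.indepWeight y (W \ G.closedNbhd W u) := by
  have hcover : ∀ A ∈ G.maximalIndepSets W,
      y ^ A.card ≤ ∑ u ∈ G.closedNbhd W v, if u ∈ A then y ^ A.card else 0 := by
    intro A hA
    obtain ⟨hAW, -, hM⟩ := mem_maximalIndepSets.1 hA
    obtain ⟨u, hu, huA⟩ : ∃ u ∈ G.closedNbhd W v, u ∈ A := by
      by_cases hvA : v ∈ A
      · exact ⟨v, self_mem_closedNbhd hv, hvA⟩
      · obtain ⟨a, ha, hav⟩ := hM v hv hvA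
        exact ⟨a, mem_closedNbhd.2 ⟨hAW ha, Or.inr hav.symm⟩, ha⟩
    refine le_trans (if_pos huA).ge (Finset.single_le_sum
      (f := fun u => if u ∈ A then y ^ A.card else 0) (fun u _ => ?_) hu)
    positivity
  refine (Finset.sum_le_sum hcover).trans ?_
  rw [Finset.sum_comm]
  refine Finset.sum_le_sum fun u _ => ?_
  rw [← Finset.sum_filter]
  rw [indepWeight, Finset.mul_sum]
  -- All these sets contain `u`, so erasing it loses no information.
  have hinj : Set.InjOn (fun A : Finset V => A.erase u)
      ({A ∈ G.maximalIndepSets W | u ∈ A} : Finset (Finset V)) := by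
    intro A hA B hB hAB
    simp only [Finset.coe_filter, Set.mem_ofPred_eq] at hA hB
    rw [← Finset.insert_erase hA.2, ← Finset.insert_erase hB.2]
    exact congrArg (insert u) hAB
  calc ∑ A ∈ G.maximalIndepSets W with u ∈ A, y ^ A.card
      = ∑ A ∈ G.maximalIndepSets W with u ∈ A, y * y ^ (A.erase u).card := by
        refine Finset.sum_congr rfl fun A hA => ?_
        rw [← Finset.card_erase_add_one (Finset.mem_filter.1 hA).2, pow_succ']
    _ = ∑ B ∈ Finset.image (fun A : Finset V => A.erase u)
          {A ∈ G.maximalIndepSets W | u ∈ A}, y * y ^ B.card :=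
        (Finset.sum_image (f := fun B : Finset V => y * y ^ B.card) hinj).symm
    _ ≤ _ := by
        refine Finset.sum_le_sum_of_subset_of_nonneg ?_ fun _ _ _ =>
          mul_nonneg hy (pow_nonneg hy _)
        intro B hB
        obtain ⟨A, hA, rfl⟩ := Finset.mem_image.1 hB
        rw [Finset.mem_filter] at hA
        exact erase_mem_maximalIndepSets hA.1 hA.2

lemma card_sdiff_closedNbhd (W : Finset V) (u : V) :
    (W \ G.closedNbhd W u).card + (G.closedNbhd W u).card = W.card :=
  Finset.card_sdiff_add_card_eq_card (closedNbhd_subset W u)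

lemma sdiff_closedNbhd_ssubset {W : Finset V} {u : V} (hu : u ∈ W) :
    W \ G.closedNbhd W u ⊂ W :=
  Finset.sdiff_ssubset (closedNbhd_subset W u) ⟨u, self_mem_closedNbhd hu⟩

/-- Branching on a vertex `v` whose closed neighbourhood has the least size. -/
lemma indepWeight_mul_pow_le {y c : ℝ} (hy : 0 ≤ y) (hc : 1 ≤ c) {W : Finset V}
    (ih : ∀ U ⊂ W, G.indepWeight y U ≤ c ^ U.card) {v : V} (hv : v ∈ W)
    (hmin : ∀ u ∈ W, (G.closedNbhd W v).card ≤ (G.closedNbhd W u).card) :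
    G.indepWeight y W * c ^ (G.closedNbhd W v).card ≤
      (G.closedNbhd W v).card * y * c ^ W.card := by
  have hterm : ∀ u ∈ G.closedNbhd W v,
      y * G.indepWeight y (W \ G.closedNbhd W u) * c ^ (G.closedNbhd W v).card ≤
        y * c ^ W.card := by
    intro u hu
    have huW := closedNbhd_subset W v hu
    have h1 := ih _ (sdiff_closedNbhd_ssubset (G := G) huW)
    rw [← card_sdiff_closedNbhd (G := G) W u, pow_add, mul_assoc]
    refine mul_le_mul_of_nonneg_left ?_ hy
    exact mul_le_mul h1 (pow_le_pow_right₀ hc (hmin u huW)) (by positivity) (by positivity)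
  calc G.indepWeight y W * c ^ (G.closedNbhd W v).card
      ≤ (∑ u ∈ G.closedNbhd W v, y * G.indepWeight y (W \ G.closedNbhd W u)) *
          c ^ (G.closedNbhd W v).card :=
        mul_le_mul_of_nonneg_right (indepWeight_le_sum hy hv) (by positivity)
    _ ≤ ∑ _u ∈ G.closedNbhd W v, y * c ^ W.card := by
        rw [Finset.sum_mul]
        exact Finset.sum_le_sum hterm
    _ = _ := by rw [Finset.sum_const, nsmul_eq_mul, mul_assoc]

/-- The hypothesis on `r` closes the induction whatever the least closed neighbourhood size is. -/
lemma indepWeight_le_pow {y c : ℝ} (hy : 0 ≤ y) (hc : 1 ≤ c)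
    (hyc : ∀ r : ℕ, r * y ≤ c ^ r) (W : Finset V) : G.indepWeight y W ≤ c ^ W.card := by
  induction W using Finset.strongInduction with
  | H W ih =>
    rcases W.eq_empty_or_nonempty with rfl | hW
    · simp [indepWeight_empty]
    obtain ⟨v, hv, hmin⟩ := W.exists_min_image (fun u => (G.closedNbhd W u).card) hW
    have h := indepWeight_mul_pow_le hy hc ih hv hmin
    have h2 := mul_le_mul_of_nonneg_right (hyc (G.closedNbhd W v).card)
      (show (0 : ℝ) ≤ c ^ W.card by positivity)
    refine le_of_mul_le_mul_right ((h.trans h2).trans_eq (mul_comm _ _)) (by positivity)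

/-! ### The gain in the absence of 4-cliques -/

/-- The closed neighbourhood of a vertex is a clique if it is the closed neighbourhood of each of
its vertices. -/
lemma isClique_closedNbhd {W : Finset V} {u : V}
    (h : ∀ w ∈ G.closedNbhd W u, G.closedNbhd W u ⊆ G.closedNbhd W w) :
    G.IsClique (G.closedNbhd W u : Set V) := by
  intro a ha b hb hab
  exact (mem_closedNbhd.1 (h a ha hb)).2.resolve_left (Ne.symm hab)

/-- If a vertex of degree `3` lies in a cubic neighbourhood that is not a component, deleting its
closed neighbourhood creates a vertex of smaller degree. -/
lemma exists_card_closedNbhd_le_three {W : Finset V} (hW : ∀ Q ⊆ W, ¬ G.IsNClique 4 Q)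
    (hreg : ∀ v ∈ W, (G.closedNbhd W v).card = 4 →
      ∀ u ∈ G.closedNbhd W v, (G.closedNbhd W u).card = 4)
    {u : V} (hu : u ∈ W) (hu4 : (G.closedNbhd W u).card = 4) :
    ∃ z ∈ W \ G.closedNbhd W u,
      (G.closedNbhd (W \ G.closedNbhd W u) z).card ≤ 3 := by
  by_contra! hcon
  refine hW _ (closedNbhd_subset W u) ⟨isClique_closedNbhd fun w hw => ?_, hu4⟩
  have hwW := closedNbhd_subset W u hw
  have hw4 := hreg u hu hu4 w hw
  suffices hsub : G.closedNbhd W w ⊆ G.closedNbhd W u from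
    (Finset.eq_of_subset_of_card_le hsub (by omega)).ge
  intro z hz
  by_contra hzu
  have hzW := closedNbhd_subset W w hz
  have hz4 := hreg w hwW hw4 z hz
  have h3 := hcon z (Finset.mem_sdiff.2 ⟨hzW, hzu⟩)
  -- The vertex `z` loses its neighbour `w`, which lies in the deleted set, so its closed
  -- neighbourhood drops below 4.
  have hss : G.closedNbhd (W \ G.closedNbhd W u) z ⊂ G.closedNbhd W z := by
    refine Finset.ssubset_iff_subset_ne.2 ⟨fun a ha => ?_, fun heq => ?_⟩
    · rw [mem_closedNbhd] at ha ⊢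
      exact ⟨(Finset.mem_sdiff.1 ha.1).1, ha.2⟩
    · have := heq ▸ mem_closedNbhd_comm hwW hz
      exact (Finset.mem_sdiff.1 (mem_closedNbhd.1 this).1).2 hw
  have := Finset.card_lt_card hss
  omega

/-- The case `r = 4` fails narrowly: `4y ≈ 2.773` against `1.29^4 ≈ 2.769`. From `r = 5` on, the
ratio `(r + 1)/r ≤ 6/5` is below 1.29. -/
lemma nat_mul_le_pow (r : ℕ) (hr : r ≠ 4) :
    (r : ℝ) * (10000 / 14423) ≤ (129 / 100 : ℝ) ^ r := by
  have h5 : ∀ m : ℕ, ((m + 5 : ℕ) : ℝ) * (10000 / 14423) ≤ (129 / 100 : ℝ) ^ (m + 5) := by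
    intro m
    induction m with
    | zero => norm_num
    | succ k ih =>
      have hk : (0 : ℝ) ≤ k := Nat.cast_nonneg k
      rw [show k + 1 + 5 = (k + 5) + 1 by ring, pow_succ]
      push_cast at ih ⊢
      nlinarith
  rcases lt_or_ge r 5 with h | h
  · interval_cases r <;> first | exact absurd rfl hr | norm_num
  · obtain ⟨m, rfl⟩ := Nat.exists_eq_add_of_le' h
    exact h5 m

/-- The base is `3^(1/3)` rounded up; `r = 3` is the tight case. -/
lemma nat_le_pow (r : ℕ) : (r : ℝ) * 1 ≤ (14423 / 10000 : ℝ) ^ r := by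
  have h3 : ∀ m : ℕ, ((m + 3 : ℕ) : ℝ) * 1 ≤ (14423 / 10000 : ℝ) ^ (m + 3) := by
    intro m
    induction m with
    | zero => norm_num
    | succ k ih =>
      have hk : (0 : ℝ) ≤ k := Nat.cast_nonneg k
      rw [show k + 1 + 3 = (k + 3) + 1 by ring, pow_succ]
      push_cast at ih ⊢
      nlinarith
  rcases lt_or_ge r 3 with h | h
  · interval_cases r <;> norm_num
  · obtain ⟨m, rfl⟩ := Nat.exists_eq_add_of_le' h
    exact h3 m

/-- The branching step at a vertex of degree `3` with a neighbour of larger degree. -/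
lemma indepWeight_le_of_irregular {W : Finset V}
    (ih : ∀ U ⊂ W, G.indepWeight (10000 / 14423) U ≤ (129 / 100 : ℝ) ^ U.card)
    (hmin : ∀ u ∈ W, 4 ≤ (G.closedNbhd W u).card) {v : V} (hv : v ∈ W)
    (hv4 : (G.closedNbhd W v).card = 4) {w : V} (hw : w ∈ G.closedNbhd W v)
    (hw4 : (G.closedNbhd W w).card ≠ 4) :
    G.indepWeight (10000 / 14423) W ≤ (129 / 100 : ℝ) ^ W.card := by
  have hterm : ∀ u ∈ W, ∀ k ≤ (G.closedNbhd W u).card,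
      G.indepWeight (10000 / 14423) (W \ G.closedNbhd W u) * (129 / 100 : ℝ) ^ k ≤
        (129 / 100 : ℝ) ^ W.card := by
    intro u hu k hk
    rw [← card_sdiff_closedNbhd (G := G) W u, pow_add]
    exact mul_le_mul (ih _ (sdiff_closedNbhd_ssubset hu))
      (pow_le_pow_right₀ (by norm_num) hk) (by positivity) (by positivity)
  have hsum := indepWeight_le_sum (G := G) (y := 10000 / 14423) (by norm_num) hv
  rw [← Finset.add_sum_erase _ _ hw] at hsum
  have hwW := closedNbhd_subset W v hw
  have h5 := hterm w hwW 5 (by have := hmin w hwW; omega)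
  have hrest : ∑ u ∈ (G.closedNbhd W v).erase w,
      10000 / 14423 * G.indepWeight (10000 / 14423) (W \ G.closedNbhd W u) ≤
      ∑ _u ∈ (G.closedNbhd W v).erase w,
        10000 / 14423 * ((129 / 100 : ℝ) ^ W.card / (129 / 100) ^ 4) := by
    refine Finset.sum_le_sum fun u hu => mul_le_mul_of_nonneg_left ?_ (by norm_num)
    have huW := closedNbhd_subset W v (Finset.mem_of_mem_erase hu)
    rw [le_div_iff₀ (by positivity)]
    exact hterm u huW 4 (hmin u huW)
  rw [Finset.sum_const, Finset.card_erase_of_mem hw, hv4, nsmul_eq_mul] at hrest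
  have hpos : (0 : ℝ) < (129 / 100 : ℝ) ^ W.card := by positivity
  -- With `c = 1.29`, this is `3y/c^4 + y/c^5 ≈ 0.945 < 1`.
  norm_num at h5 hrest hsum ⊢
  linarith

/-- The branching step at a vertex of degree `3` whose neighbourhood is cubic. -/
lemma indepWeight_le_of_regular {W : Finset V} (hW : ∀ Q ⊆ W, ¬ G.IsNClique 4 Q)
    (ih : ∀ U ⊂ W, G.indepWeight (10000 / 14423) U ≤ (129 / 100 : ℝ) ^ U.card)
    (hreg : ∀ v ∈ W, (G.closedNbhd W v).card = 4 →
      ∀ u ∈ G.closedNbhd W v, (G.closedNbhd W u).card = 4)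
    {v : V} (hv : v ∈ W) (hv4 : (G.closedNbhd W v).card = 4) :
    G.indepWeight (10000 / 14423) W ≤ (129 / 100 : ℝ) ^ W.card := by
  have hpos : (0 : ℝ) < (129 / 100 : ℝ) ^ W.card := by positivity
  have hterm : ∀ u ∈ G.closedNbhd W v,
      10000 / 14423 * G.indepWeight (10000 / 14423) (W \ G.closedNbhd W u) ≤
        (1 / 4) * (129 / 100 : ℝ) ^ W.card := by
    intro u hu
    have huW := closedNbhd_subset W v hu
    have hu4 := hreg v hv hv4 u hu
    obtain ⟨z, hz, hz3⟩ := exists_card_closedNbhd_le_three hW hreg huW hu4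
    have hcard := card_sdiff_closedNbhd (G := G) W u
    have hss := sdiff_closedNbhd_ssubset (G := G) huW
    set U := W \ G.closedNbhd W u
    obtain ⟨x, hx, hmin⟩ := U.exists_min_image (fun a => (G.closedNbhd U a).card) ⟨z, hz⟩
    -- A second branching, now on at most 3 vertices, gains at least the factor `3y/c^3 ≈ 0.969`.
    -- This outweighs the excess of `y/c^4 ≈ 0.2504` over `1/4`.
    have h := indepWeight_mul_pow_le (G := G) (y := 10000 / 14423) (c := 129 / 100)
      (by norm_num) (by norm_num) (fun T hT => ih T (hT.trans hss)) hx hmin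
    have hx3 := (hmin z hz).trans hz3
    have hx1 : 0 < (G.closedNbhd U x).card := Finset.card_pos.2 ⟨x, self_mem_closedNbhd hx⟩
    rw [hu4] at hcard
    rw [← hcard, pow_add]
    rw [← hcard, pow_add] at hpos
    have hUpos : (0 : ℝ) < (129 / 100 : ℝ) ^ U.card := by positivity
    generalize (G.closedNbhd U x).card = r at h hx3 hx1
    interval_cases r <;> norm_num at h ⊢ <;> linarith
  calc G.indepWeight (10000 / 14423) W
      ≤ ∑ u ∈ G.closedNbhd W v, 10000 / 14423 *
          G.indepWeight (10000 / 14423) (W \ G.closedNbhd W u) :=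
        indepWeight_le_sum (by norm_num) hv
    _ ≤ ∑ _u ∈ G.closedNbhd W v, (1 / 4) * (129 / 100 : ℝ) ^ W.card := Finset.sum_le_sum hterm
    _ = _ := by rw [Finset.sum_const, hv4, nsmul_eq_mul]; push_cast; ring

/-- The bound on weighted maximal independent sets in a `K₄`-free graph. -/
lemma indepWeight_le_pow_of_cliqueFree (W : Finset V) (hW : ∀ Q ⊆ W, ¬ G.IsNClique 4 Q) :
    G.indepWeight (10000 / 14423) W ≤ (129 / 100 : ℝ) ^ W.card := by
  induction W using Finset.strongInduction with
  | H W IH =>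
    have ih : ∀ U ⊂ W, G.indepWeight (10000 / 14423) U ≤ (129 / 100 : ℝ) ^ U.card :=
      fun U hU => IH U hU fun Q hQ => hW Q (hQ.trans hU.subset)
    rcases W.eq_empty_or_nonempty with rfl | hne
    · simp [indepWeight_empty]
    obtain ⟨v, hv, hmin⟩ := W.exists_min_image (fun u => (G.closedNbhd W u).card) hne
    by_cases hv4 : (G.closedNbhd W v).card = 4
    · by_cases hreg : ∀ v ∈ W, (G.closedNbhd W v).card = 4 →
          ∀ u ∈ G.closedNbhd W v, (G.closedNbhd W u).card = 4
      · exact indepWeight_le_of_regular hW ih hreg hv hv4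
      · push Not at hreg
        obtain ⟨a, ha, ha4, w, hw, hw4⟩ := hreg
        exact indepWeight_le_of_irregular ih (fun u hu => hv4 ▸ hmin u hu) ha ha4 hw hw4
    · have h := indepWeight_mul_pow_le (y := 10000 / 14423) (c := 129 / 100)
        (by norm_num) (by norm_num) ih hv hmin
      have h2 := mul_le_mul_of_nonneg_right (nat_mul_le_pow _ hv4)
        (show (0 : ℝ) ≤ (129 / 100 : ℝ) ^ W.card by positivity)
      exact le_of_mul_le_mul_right ((h.trans h2).trans_eq (mul_comm _ _)) (by positivity)

/-! ### From independent sets to bipartite sets -/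

lemma card_maximalIndepSets_le (W : Finset V) :
    ((G.maximalIndepSets W).card : ℝ) ≤ (14423 / 10000 : ℝ) ^ W.card := by
  have h := indepWeight_le_pow (G := G) (y := 1) (by norm_num) (by norm_num) nat_le_pow W
  simpa [indepWeight] using h

/-- Every independent subset of `W` extends to a maximal one. -/
lemma exists_mem_maximalIndepSets {W A : Finset V} (hAW : A ⊆ W)
    (hA : G.IsIndepSet (A : Set V)) : ∃ I ∈ G.maximalIndepSets W, A ⊆ I := by
  classical
  obtain ⟨I, hAI, hI⟩ := Finset.exists_le_maximal
    ({I ∈ W.powerset | G.IsIndepSet (I : Set V)} : Finset (Finset V)) (a := A) (by simp [*])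
  obtain ⟨hIW, hind⟩ : I ⊆ W ∧ G.IsIndepSet (I : Set V) := by simpa using hI.1
  refine ⟨I, mem_maximalIndepSets.2 ⟨hIW, hind, fun w hw hwI => ?_⟩, hAI⟩
  by_contra! hno
  have hins : G.IsIndepSet (insert w I : Finset V) := by
    rw [Finset.coe_insert]
    exact hind.insert fun a ha _ => ⟨fun h => hno a ha h.symm, hno a ha⟩
  have hle := hI.2 (y := insert w I)
    (Finset.mem_filter.2 ⟨Finset.mem_powerset.2 (Finset.insert_subset hw hIW), hins⟩)
    (Finset.subset_insert w I)
  exact hwI (hle (Finset.mem_insert_self w I))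

/-- Enlarge one colour class to a maximal independent set `I`, then the rest of the other to a
maximal one in `W \ I`. The union is still bipartite, so maximality makes it equal to `S`. -/
lemma maximalBipartiteSets_subset_image (W : Finset V) :
    G.maximalBipartiteSets W ⊆
      (G.maximalIndepSets W).biUnion fun A => (G.maximalIndepSets (W \ A)).image (A ∪ ·) := by
  intro S hS
  obtain ⟨hSW, ⟨A, B, hA, hB, rfl⟩, hmax⟩ := mem_maximalBipartiteSets.1 hS
  obtain ⟨I, hI, hAI⟩ := exists_mem_maximalIndepSets (Finset.union_subset_left hSW) hA
  obtain ⟨J, hJ, hBJ⟩ := exists_mem_maximalIndepSets (W := W \ I) (A := B \ I)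
    (Finset.sdiff_subset_sdiff (Finset.union_subset_right hSW) subset_rfl)
    (hB.mono (by simp))
  obtain ⟨hIW, hIind, -⟩ := mem_maximalIndepSets.1 hI
  obtain ⟨hJW, hJind, -⟩ := mem_maximalIndepSets.1 hJ
  rw [Finset.mem_biUnion]
  refine ⟨I, hI, Finset.mem_image.2 ⟨J, hJ, ?_⟩⟩
  refine hmax _ (Finset.union_subset hIW (hJW.trans Finset.sdiff_subset))
    ⟨I, J, hIind, hJind, rfl⟩ fun x hx => ?_
  by_cases hxI : x ∈ I
  · exact Finset.mem_union_left _ hxI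
  · refine Finset.mem_union_right _ (hBJ (Finset.mem_sdiff.2 ⟨?_, hxI⟩))
    exact (Finset.mem_union.1 hx).resolve_left fun h => hxI (hAI h)

/-- The count for `W \ A` carries the factor `y^|A|` relative to the count for `W`, which turns the
sum over `A` into `indepWeight`. -/
lemma card_maximalBipartiteSets_le_of_cliqueFree (W : Finset V)
    (hW : ∀ Q ⊆ W, ¬ G.IsNClique 4 Q) :
    ((G.maximalBipartiteSets W).card : ℝ) ≤ (14423 / 10000 * (129 / 100) : ℝ) ^ W.card := by
  have h1 : (G.maximalBipartiteSets W).card ≤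
      ∑ A ∈ G.maximalIndepSets W, (G.maximalIndepSets (W \ A)).card :=
    (Finset.card_le_card (maximalBipartiteSets_subset_image W)).trans <|
      Finset.card_biUnion_le.trans <| Finset.sum_le_sum fun A _ => Finset.card_image_le
  calc ((G.maximalBipartiteSets W).card : ℝ)
      ≤ ∑ A ∈ G.maximalIndepSets W, ((G.maximalIndepSets (W \ A)).card : ℝ) := by
        exact_mod_cast h1
    _ ≤ ∑ A ∈ G.maximalIndepSets W,
          (14423 / 10000 : ℝ) ^ W.card * (10000 / 14423) ^ A.card := by
        refine Finset.sum_le_sum fun A hA => (card_maximalIndepSets_le _).trans_eq ?_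
        rw [← Finset.card_sdiff_add_card_eq_card (mem_maximalIndepSets.1 hA).1, pow_add,
          mul_assoc, ← mul_pow]
        norm_num
    _ = (14423 / 10000 : ℝ) ^ W.card * G.indepWeight (10000 / 14423) W := by
        rw [indepWeight, Finset.mul_sum]
    _ ≤ _ := by
        rw [mul_pow]
        exact mul_le_mul_of_nonneg_left (indepWeight_le_pow_of_cliqueFree W hW) (by positivity)

/-! ### Splitting off 4-cliques in maximum degree at most 3 -/

lemma IsBipartiteSet.mono {S T : Finset V} (hT : G.IsBipartiteSet T) (h : S ⊆ T) :
    G.IsBipartiteSet S := by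
  obtain ⟨A, B, hA, hB, rfl⟩ := hT
  refine ⟨A ∩ S, B ∩ S, hA.mono (by simp), hB.mono (by simp), ?_⟩
  rw [← Finset.union_inter_distrib_right, Finset.inter_eq_right.2 h]

lemma IsBipartiteSet.card_inter_clique_le {S Q : Finset V} (hS : G.IsBipartiteSet S)
    (hQ : G.IsClique (Q : Set V)) : (S ∩ Q).card ≤ 2 := by
  obtain ⟨A, B, hA, hB, rfl⟩ := hS
  have hone : ∀ A : Finset V, G.IsIndepSet (A : Set V) → (A ∩ Q).card ≤ 1 := by
    intro A hA
    refine Finset.card_le_one.2 fun a ha b hb => ?_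
    rw [Finset.mem_inter] at ha hb
    by_contra hab
    exact hA ha.1 hb.1 hab (hQ ha.2 hb.2 hab)
  rw [Finset.union_inter_distrib_right]
  have := Finset.card_union_le (A ∩ Q) (B ∩ Q)
  have := hone A hA
  have := hone B hB
  omega

lemma IsIndepSet.union_of_not_adj {A B : Finset V} (hA : G.IsIndepSet (A : Set V))
    (hB : G.IsIndepSet (B : Set V)) (h : ∀ a ∈ A, ∀ b ∈ B, ¬ G.Adj a b) :
    G.IsIndepSet ((A ∪ B : Finset V) : Set V) := by
  intro x hx y hy hxy
  rw [Finset.mem_coe, Finset.mem_union] at hx hy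
  rcases hx with hx | hx <;> rcases hy with hy | hy
  · exact hA hx hy hxy
  · exact h x hx y hy
  · exact fun hadj => h y hy x hx hadj.symm
  · exact hB hx hy hxy

lemma IsBipartiteSet.union_of_not_adj {S T : Finset V} (hS : G.IsBipartiteSet S)
    (hT : G.IsBipartiteSet T) (h : ∀ a ∈ S, ∀ b ∈ T, ¬ G.Adj a b) :
    G.IsBipartiteSet (S ∪ T) := by
  obtain ⟨A, B, hA, hB, rfl⟩ := hS
  obtain ⟨A', B', hA', hB', rfl⟩ := hT
  refine ⟨A ∪ A', B ∪ B', hA.union_of_not_adj hA' fun a ha b hb => ?_,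
    hB.union_of_not_adj hB' fun a ha b hb => ?_, Finset.union_union_union_comm _ _ _ _⟩
  · exact h a (Finset.mem_union_left _ ha) b (Finset.mem_union_left _ hb)
  · exact h a (Finset.mem_union_right _ ha) b (Finset.mem_union_right _ hb)

/-- No edges leave `Q`, so a bipartite extension of `S \ Q` can be glued to `S ∩ Q`, and maximality
of `S` applies. -/
lemma sdiff_mem_maximalBipartiteSets {W Q S : Finset V}
    (hsep : ∀ a ∈ Q, ∀ b ∈ W \ Q, ¬ G.Adj a b)
    (hS : S ∈ G.maximalBipartiteSets W) : S \ Q ∈ G.maximalBipartiteSets (W \ Q) := by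
  obtain ⟨hSW, hSb, hmax⟩ := mem_maximalBipartiteSets.1 hS
  refine mem_maximalBipartiteSets.2 ⟨Finset.sdiff_subset_sdiff hSW subset_rfl,
    hSb.mono Finset.sdiff_subset, fun T hTW hT hST => ?_⟩
  have hbip : G.IsBipartiteSet ((S ∩ Q) ∪ T) :=
    (hSb.mono Finset.inter_subset_left).union_of_not_adj hT fun a ha b hb =>
      hsep a (Finset.mem_inter.1 ha).2 b (hTW hb)
  have heq := hmax _ (Finset.union_subset (Finset.inter_subset_left.trans hSW)
    (hTW.trans Finset.sdiff_subset)) hbip fun x hx => by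
      by_cases hxQ : x ∈ Q
      · exact Finset.mem_union_left _ (Finset.mem_inter.2 ⟨hx, hxQ⟩)
      · exact Finset.mem_union_right _ (hST (Finset.mem_sdiff.2 ⟨hx, hxQ⟩))
  refine (hST.antisymm fun x hx => Finset.mem_sdiff.2 ⟨?_, ?_⟩).symm
  · exact heq ▸ Finset.mem_union_right _ hx
  · exact (Finset.mem_sdiff.1 (hTW hx)).2

/-- A bipartite set meets a `4`-clique in one of its `11` subsets of size at most `2`. -/
lemma card_maximalBipartiteSets_le_mul {W Q : Finset V} (hQ : G.IsNClique 4 Q)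
    (hsep : ∀ a ∈ Q, ∀ b ∈ W \ Q, ¬ G.Adj a b) :
    (G.maximalBipartiteSets W).card ≤ 11 * (G.maximalBipartiteSets (W \ Q)).card := by
  have hcount : ({R ∈ Q.powerset | R.card ≤ 2} : Finset (Finset V)).card ≤ 11 := by
    have hsub : ({R ∈ Q.powerset | R.card ≤ 2} : Finset (Finset V)) ⊆
        (Finset.range 3).biUnion fun k => Q.powersetCard k := by
      intro R hR
      simp only [Finset.mem_filter, Finset.mem_powerset] at hR
      simp only [Finset.mem_biUnion, Finset.mem_range, Finset.mem_powersetCard]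
      exact ⟨R.card, by omega, hR.1, rfl⟩
    refine (Finset.card_le_card hsub).trans (Finset.card_biUnion_le.trans ?_)
    -- `1 + 4 + 6 = 11`.
    simp [Finset.sum_range_succ, Finset.card_powersetCard, hQ.card_eq, Nat.choose]
  calc (G.maximalBipartiteSets W).card
      ≤ (({R ∈ Q.powerset | R.card ≤ 2} : Finset (Finset V)) ×ˢ
          G.maximalBipartiteSets (W \ Q)).card := by
        refine Finset.card_le_card_of_injOn (fun S => (S ∩ Q, S \ Q)) (fun S hS => ?_) ?_
        · have hb := (mem_maximalBipartiteSets.1 hS).2.1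
          simp only [Finset.coe_product, Set.mem_prod, Finset.mem_coe, Finset.mem_filter,
            Finset.mem_powerset]
          exact ⟨⟨Finset.inter_subset_right, hb.card_inter_clique_le hQ.isClique⟩,
            sdiff_mem_maximalBipartiteSets hsep hS⟩
        · intro S _ T _ hST
          rw [Prod.mk.injEq] at hST
          rw [← Finset.sdiff_union_inter S Q, ← Finset.sdiff_union_inter T Q, hST.1, hST.2]
    _ ≤ _ := by
        rw [Finset.card_product]
        exact Nat.mul_le_mul_right _ hcount

/-- In a graph of maximum degree at most `3`, a `4`-clique is a component. -/
lemma not_adj_of_isNClique_four [Fintype V] [DecidableRel G.Adj] (hdeg : ∀ v, G.degree v ≤ 3)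
    {Q : Finset V} (hQ : G.IsNClique 4 Q) {a b : V} (ha : a ∈ Q) (hb : b ∉ Q) :
    ¬ G.Adj a b := by
  intro hab
  have hsub : insert b (Q.erase a) ⊆ G.neighborFinset a := by
    intro x hx
    rw [mem_neighborFinset]
    rcases Finset.mem_insert.1 hx with rfl | hx
    · exact hab
    · rw [Finset.mem_erase] at hx
      exact hQ.isClique ha hx.2 (Ne.symm hx.1)
  have h := Finset.card_le_card hsub
  rw [Finset.card_insert_of_notMem fun h => hb (Finset.mem_of_mem_erase h),
    Finset.card_erase_of_mem ha, hQ.card_eq, card_neighborFinset_eq_degree] at h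
  have := hdeg a
  omega

lemma card_maximalBipartiteSets_le_of_degree_le [Fintype V] [DecidableRel G.Adj]
    (hdeg : ∀ v, G.degree v ≤ 3) (W : Finset V) :
    ((G.maximalBipartiteSets W).card : ℝ) ≤ (14423 / 10000 * (129 / 100) : ℝ) ^ W.card := by
  induction W using Finset.strongInduction with
  | H W ih =>
    by_cases hW : ∀ Q ⊆ W, ¬ G.IsNClique 4 Q
    · exact card_maximalBipartiteSets_le_of_cliqueFree W hW
    push Not at hW
    obtain ⟨Q, hQW, hQ⟩ := hW
    have hne : Q.Nonempty := Finset.card_pos.1 (by rw [hQ.card_eq]; norm_num)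
    have h1 := card_maximalBipartiteSets_le_mul (W := W) hQ (fun a ha b hb =>
      not_adj_of_isNClique_four hdeg hQ ha (Finset.mem_sdiff.1 hb).2)
    have h2 := ih _ (Finset.sdiff_ssubset hQW hne)
    have h3 : ((G.maximalBipartiteSets W).card : ℝ) ≤
        11 * (G.maximalBipartiteSets (W \ Q)).card := by exact_mod_cast h1
    rw [← Finset.card_sdiff_add_card_eq_card hQW, hQ.card_eq, pow_add]
    have hpos : (0 : ℝ) < (14423 / 10000 * (129 / 100) : ℝ) ^ (W \ Q).card := by positivity
    -- The right side is about 11.98, so the crude count 11 suffices.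
    have h4 : (11 : ℝ) ≤ (14423 / 10000 * (129 / 100) : ℝ) ^ 4 := by norm_num
    nlinarith

/-! ### Translation between induced subgraphs and vertex sets -/

lemma isBipartiteSet_of_coe_isBipartite {H : G.Subgraph} (hind : H.IsInduced)
    (hH : H.coe.IsBipartite) {S : Finset V} (hS : (S : Set V) = H.verts) :
    G.IsBipartiteSet S := by
  classical
  obtain ⟨f⟩ := hH
  have hclass : ∀ i : Fin 2, G.IsIndepSet
      (({v ∈ S | ∃ h : v ∈ H.verts, f ⟨v, h⟩ = i} : Finset V) : Set V) := by
    intro i x hx y hy _ hadj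
    obtain ⟨-, hx, hxi⟩ := Finset.mem_filter.1 (Finset.mem_coe.1 hx)
    obtain ⟨-, hy, hyi⟩ := Finset.mem_filter.1 (Finset.mem_coe.1 hy)
    have hne : f ⟨x, hx⟩ ≠ f ⟨y, hy⟩ := f.valid (hind hx hy hadj)
    exact hne (hxi.trans hyi.symm)
  refine ⟨_, _, hclass 0, hclass 1, ?_⟩
  ext v
  simp only [Finset.mem_union, Finset.mem_filter, ← and_or_left]
  refine ⟨fun hv => ⟨hv, ?_⟩, fun hv => hv.1⟩
  have hvH : v ∈ H.verts := hS ▸ Finset.mem_coe.2 hv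
  rcases Fin.exists_fin_two.1 ⟨f ⟨v, hvH⟩, rfl⟩ with h | h
  · exact Or.inl ⟨hvH, h⟩
  · exact Or.inr ⟨hvH, h⟩

lemma IsBipartiteSet.coe_induce_isBipartite {S : Finset V} (hS : G.IsBipartiteSet S) :
    ((⊤ : G.Subgraph).induce (S : Set V)).coe.IsBipartite := by
  obtain ⟨A, B, hA, hB, rfl⟩ := hS
  -- `A` and `B` may overlap; vertices outside `A` necessarily lie in `B`.
  refine ⟨Coloring.mk (fun v => if (v : V) ∈ A then (0 : Fin 2) else 1) ?_⟩
  rintro ⟨x, hx⟩ ⟨y, hy⟩ hadj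
  obtain ⟨-, -, hadj⟩ : x ∈ ((A ∪ B : Finset V) : Set V) ∧ y ∈ ((A ∪ B : Finset V) : Set V) ∧
    G.Adj x y := hadj
  have hx' : x ∈ A ∪ B := hx
  have hy' : y ∈ A ∪ B := hy
  rw [Finset.mem_union] at hx' hy'
  have hAA : x ∈ A → y ∉ A := fun h1 h2 => hA h1 h2 hadj.ne hadj
  have hBB : x ∈ B → y ∉ B := fun h1 h2 => hB h1 h2 hadj.ne hadj
  by_cases h1 : x ∈ A <;> by_cases h2 : y ∈ A <;> simp_all

/-- An induced subgraph is determined by its vertex set, and maximality passes to that set. -/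
lemma numMaximalInducedBipartite_le [Fintype V] :
    G.numMaximalInducedBipartite ≤ (G.maximalBipartiteSets Finset.univ).card := by
  classical
  rw [numMaximalInducedBipartite, ← Set.ncard_coe_finset]
  refine Set.ncard_le_ncard_of_injOn (fun H : G.Subgraph => H.verts.toFinset) ?_ ?_
    (Finset.finite_toSet _)
  · intro H hH
    obtain ⟨⟨hind, hbip⟩, hmax⟩ : G.IsMaximalInducedBipartite H := hH
    refine Finset.mem_coe.2 (mem_maximalBipartiteSets.2 ⟨Finset.subset_univ _,
      isBipartiteSet_of_coe_isBipartite hind hbip (Set.coe_toFinset _), fun T _ hT hST => ?_⟩)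
    have hle : H ≤ (⊤ : G.Subgraph).induce (T : Set V) :=
      Subgraph.le_induce_top_verts.trans
        (Subgraph.induce_mono_right (by simpa using Finset.coe_subset.2 hST))
    have hge := hmax ⟨(Subgraph.isInduced_iff_exists_eq_induce_top _).2 ⟨_, rfl⟩,
      hT.coe_induce_isBipartite⟩ hle
    refine (hST.antisymm fun x hx => Set.mem_toFinset.2 (hge.1 ?_)).symm
    exact hx
  · intro H hH K hK hHK
    have hv : H.verts = K.verts := Set.toFinset_inj.1 hHK
    have hH' : H.IsInduced := hH.1.1
    have hK' : K.IsInduced := hK.1.1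
    rw [← hH'.induce_top_verts, ← hK'.induce_top_verts, hv]

end SimpleGraph

theorem corollary2 :
    ∃ ν : ℝ, 0 < ν ∧ ν < 12 ∧
      (∃ C : ℝ, 0 < C ∧
        ∀ (V : Type u) [Fintype V] (G : SimpleGraph V), G.CliqueFree 4 →
          (G.numMaximalInducedBipartite : ℝ) ≤ C * (12 - ν) ^ ((Fintype.card V : ℝ) / 4)) ∧
      (∃ C : ℝ, 0 < C ∧
        ∀ (V : Type u) [Fintype V] (G : SimpleGraph V) [DecidableRel G.Adj], G.maxDegree ≤ 3 →
          (G.numMaximalInducedBipartite : ℝ) ≤ C * (12 - ν) ^ ((Fintype.card V : ℝ) / 4)) := by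
  have key : ∀ n : ℕ, (1 : ℝ) * (12 - (12 - (14423 / 10000 * (129 / 100)) ^ 4)) ^ ((n : ℝ) / 4) =
      (14423 / 10000 * (129 / 100)) ^ n := by
    intro n
    rw [one_mul, sub_sub_cancel, ← Real.rpow_natCast _ 4, ← Real.rpow_mul (by norm_num),
      ← Real.rpow_natCast]
    congr 1
    push_cast
    ring
  -- Chosen so that `12 - ν` is the fourth power of the base in the vertex-set bounds; those bounds
  -- have no leading constant, hence `C = 1`.
  refine ⟨12 - (14423 / 10000 * (129 / 100)) ^ 4, by norm_num, by norm_num,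
    ⟨1, one_pos, fun V _ G hG => ?_⟩, ⟨1, one_pos, fun V _ G _ hG => ?_⟩⟩
  · classical
    rw [key, ← Finset.card_univ]
    exact (Nat.cast_le.2 SimpleGraph.numMaximalInducedBipartite_le).trans
      (SimpleGraph.card_maximalBipartiteSets_le_of_cliqueFree _ fun Q _ => hG Q)
  · classical
    rw [key, ← Finset.card_univ]
    exact (Nat.cast_le.2 SimpleGraph.numMaximalInducedBipartite_le).trans
      (SimpleGraph.card_maximalBipartiteSets_le_of_degree_le
        (fun v => (G.degree_le_maxDegree v).trans hG) _)
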